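/- For each $n$ let $s_n\in\{0,1\}^n$ be a planted string and $C_n:\{0,1\}^n\to\mathbb Z$ a cost function that is $S_n$-symmetric relative to $s_n$, i.e. $C_n(\pi(x\oplus s_n)\oplus s_n)=C_n(x)$ for all $x$ and all permutations $\pi$ of the bits; equivalently $C_n(x)=c_n(|x\oplus s_n|)$ depends only on the Hamming distance to $s_n$. Let $0\le a\le \ell$ be integers with $\ell\neq 2a$, and suppose that, uniformly in $0\le k\le n$, $$c_n(k)=n^\ell\Big(\frac kn\Big)^a\Big(1-\frac kn\Big)^{\ell-a}+r_n(k),\qquad r_n(k)=O(n^{\ell-1})\quad(n\to\infty).$$ Suppose also that either (i) $C_n$ is a sum of clauses each depending on at most $q$ bits, with $q$ independent of $n$ (for all large $n$), or (ii) the lower-order terms vary regularly near $k=n/2$: for every $\varepsilon>0$ there is $\delta>0$ such that for all large $n$, $|r_n(k)-r_n(k')|\le\varepsilon n^{\ell-1}$ whenever $0\le k,k'\le n$ and $|k/n-\frac12|,|k'/n-\frac12|\le\delta$. Let $B=\sum_{j=1}^n X_j$, where $X_j$ is the Pauli $X$ operator on qubit $j$, let $C_n$ also denote the diagonal operator $C_n|x\rangle=C_n(x)|x\rangle$,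 and let $$|\psi_{\beta,\gamma}\rangle=e^{i\beta B}e^{i\gamma C_n}\,2^{-n/2}\sum_{x\in\{0,1\}^n}|x\rangle$$ be the 1-step QAOA state. Then with $$\gamma=\frac{2^{\ell-2}}{\ell-2a}\,\frac{\pi}{n^{\ell-1}},\qquad \beta=\frac{\pi}{4},$$ and likewise with both signs reversed (so $\beta=-\pi/4$ and $\gamma=-\frac{2^{\ell-2}}{\ell-2a}\frac{\pi}{n^{\ell-1}}$), a measurement in the computational basis yields the planted solution $s_n$ with probability $\Omega(1)$, and more precisely $$\lim_{n\to\infty}\big|\langle s_n|\psi_{\beta,\gamma}\rangle\big|^2=\Big(1+\pi^2\,\frac{[(\ell-2a)^2-\ell]^2}{16(\ell-2a)^2}\Big)^{-1/2}.$$ -/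

import Mathlib

open Filter Topology

noncomputable section

/-- Bit strings of length `n`; they also index the computational basis of `n` qubits. -/
abbrev Bits (n : ℕ) : Type := Fin n → Bool

/-- Bitwise addition modulo 2. -/
def bitXor {n : ℕ} (x y : Bits n) : Bits n := fun i => xor (x i) (y i)

/-- The action `[π(x)]_i = x_{π(i)}` of a permutation on bit strings. -/
def permuteBits {n : ℕ} (π : Equiv.Perm (Fin n)) (x : Bits n) : Bits n := fun i => x (π i)

/-- The cost function `C` is `G`-symmetric relative to the string `s`. -/
def IsSymmetricRel {n : ℕ} (G : Subgroup (Equiv.Perm (Fin n))) (s : Bits n)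
    (C : Bits n → ℤ) : Prop :=
  ∀ π ∈ G, ∀ x : Bits n, C (bitXor (permuteBits π (bitXor x s)) s) = C x

/-- The string that differs from `s` exactly in its first `k` bits, hence, for `k ≤ n`, a string
at Hamming distance `k` from `s`. -/
def flipFirst {n : ℕ} (s : Bits n) (k : ℕ) : Bits n :=
  bitXor (fun i => decide ((i : ℕ) < k)) s

/-- The cost `c(k)` at Hamming distance `k` from `s`. For a cost function that is symmetric under
all permutations relative to `s` it does not matter which string at distance `k` is taken. -/
def costAtDistance {n : ℕ} (s : Bits n) (C : Bits n → ℤ) (k : ℕ) : ℤ :=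
  C (flipFirst s k)

/-- `C` is a sum of constraint clauses, each of which depends on at most `q` bits. -/
def IsLocalCSP {n : ℕ} (q : ℕ) (C : Bits n → ℤ) : Prop :=
  ∃ (m : ℕ) (S : Fin m → Finset (Fin n)) (clause : Fin m → Bits n → ℤ),
    (∀ α, (S α).card ≤ q) ∧
    (∀ α, DependsOn (clause α) (S α : Set (Fin n))) ∧
    ∀ x, C x = ∑ α, clause α x

/-- The difference `r_n(k) = c(k) - n^ℓ (k/n)^a (1-k/n)^(ℓ-a)`. -/
def costRemainder {n : ℕ} (ℓ a : ℕ) (s : Bits n) (C : Bits n → ℤ) (k : ℕ) : ℝ :=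
  (costAtDistance s C k : ℝ)
    - (n : ℝ) ^ ℓ * ((k : ℝ) / n) ^ a * (1 - (k : ℝ) / n) ^ (ℓ - a)

/-- `c(k) = n^ℓ (k/n)^a (1-k/n)^(ℓ-a) + O(n^(ℓ-1))`, uniformly in `0 ≤ k ≤ n`. -/
def HasLeadingForm (ℓ a : ℕ) (s : ∀ n, Bits n) (C : ∀ n, Bits n → ℤ) : Prop :=
  ∃ K : ℝ, ∀ᶠ n : ℕ in atTop, ∀ k : ℕ, k ≤ n →
    |costRemainder ℓ a (s n) (C n) k| ≤ K * (n : ℝ) ^ ((ℓ : ℤ) - 1)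

/-- The clauses of the family have bounded locality, uniformly in `n`. -/
def HasBoundedLocality (C : ∀ n, Bits n → ℤ) : Prop :=
  ∃ q : ℕ, ∀ᶠ n : ℕ in atTop, IsLocalCSP q (C n)

/-- Writing the remainder as `n^(ℓ-1) ε_n(k/n)`, the functions `ε_n` are asymptotically
equicontinuous at `1/2`: the lower-order terms do not oscillate on a microscopic scale there. -/
def HasRegularRemainder (ℓ a : ℕ) (s : ∀ n, Bits n) (C : ∀ n, Bits n → ℤ) : Prop :=
  ∀ ε : ℝ, 0 < ε → ∃ δ : ℝ, 0 < δ ∧ ∀ᶠ n : ℕ in atTop, ∀ k k' : ℕ, k ≤ n → k' ≤ n →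
    |(k : ℝ) / n - 1 / 2| ≤ δ → |(k' : ℝ) / n - 1 / 2| ≤ δ →
    |costRemainder ℓ a (s n) (C n) k - costRemainder ℓ a (s n) (C n) k'|
      ≤ ε * (n : ℝ) ^ ((ℓ : ℤ) - 1)

/-- The Pauli operator `X_j` on qubit `j`: it maps `|x⟩` to `|x with bit j flipped⟩`. -/
def pauliX {n : ℕ} (j : Fin n) : Matrix (Bits n) (Bits n) ℂ :=
  Matrix.of fun x y => if x = Function.update y j (!(y j)) then 1 else 0

/-- `B = ∑_j X_j`. -/
def mixer (n : ℕ) : Matrix (Bits n) (Bits n) ℂ := ∑ j : Fin n, pauliX j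

/-- The diagonal operator `C |x⟩ = C(x) |x⟩`. -/
def costOperator {n : ℕ} (C : Bits n → ℤ) : Matrix (Bits n) (Bits n) ℂ :=
  Matrix.diagonal fun x => (C x : ℂ)

/-- The uniform superposition `2^(-n/2) ∑_x |x⟩`. -/
def plusState (n : ℕ) : Bits n → ℂ := fun _ => (((Real.sqrt (2 ^ n))⁻¹ : ℝ) : ℂ)

/-- The 1-step QAOA state `e^{iβB} e^{iγC} 2^(-n/2) ∑_x |x⟩`. -/
def qaoaState {n : ℕ} (C : Bits n → ℤ) (γ β : ℝ) : Bits n → ℂ :=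
  Matrix.mulVec (NormedSpace.exp ((Complex.I * (β : ℂ)) • mixer n))
    (Matrix.mulVec (NormedSpace.exp ((Complex.I * (γ : ℂ)) • costOperator C)) (plusState n))

/-- The probability that measuring the 1-step QAOA state in the computational basis yields `x`. -/
def qaoaProb {n : ℕ} (C : Bits n → ℤ) (γ β : ℝ) (x : Bits n) : ℝ :=
  ‖qaoaState C γ β x‖ ^ 2

/-- The angle `γ = 2^(ℓ-2) π / ((ℓ-2a) n^(ℓ-1))`. -/
def optGamma (ℓ a n : ℕ) : ℝ :=
  (2 : ℝ) ^ ((ℓ : ℤ) - 2) / ((ℓ : ℝ) - 2 * a) * (Real.pi / (n : ℝ) ^ ((ℓ : ℤ) - 1))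

/-- The limiting success probability. -/
def limitProb (ℓ a : ℕ) : ℝ :=
  (1 + Real.pi ^ 2 * (((ℓ : ℝ) - 2 * a) ^ 2 - ℓ) ^ 2 / (16 * ((ℓ : ℝ) - 2 * a) ^ 2))
    ^ (-(1 / 2) : ℝ)

end

/-! The mixer exponential is a product of one-qubit rotations, so by symmetry the amplitude at `s`
is a sum over Hamming distances (`qaoaState_apply_self`). At `β = π/4` it is the average of the unit
complex numbers `i^k e^{iγc(k)}` for `k` binomial with parameters `n` and `1/2`
(`qaoaState_opt_eq`).

Write `k = n(1+u)/2` with `u = z/√n`, where `z` is the standard score. The leading cost contributes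
the phase `πn/(4(ℓ-2a)) (1+u)^a (1-u)^(ℓ-a)`. Since `(1+u)^a (1-u)^(ℓ-a)` has linear coefficient
`2a-ℓ`, this choice of `γ` cancels the linear part of the phase `πk/2` of `i^k`. What remains is a
constant, a term `θz²` with `θ = phaseCoeff ℓ a`, and a cubic error of order `n·u³ = O(n^{-1/2})`
for bounded `z`. The remainder contributes `γ r(k)`, which is of order one but nearly constant in
`k` on the window `|z| ≤ M`, by regularity (`exists_phase_approx`). Up to a global phase the
amplitude therefore tends to `E e^{iθZ²} = (1-2iθ)^{-1/2}` with `Z` standard normal, by the central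
limit theorem (`tendsto_binomial_average`).

Bounded locality reduces to the regular case: it makes `c` a polynomial of bounded degree, and a
bounded-degree polynomial that is bounded on the grid cannot oscillate microscopically. -/

/-! ### The evolution under the mixer -/

/-- The (unnormalised) Walsh–Hadamard matrix. -/
def walsh (n : ℕ) : Matrix (Bits n) (Bits n) ℂ :=
  Matrix.of fun x z => ∏ j, if x j && z j then -1 else 1

/-- The eigenvalues of the mixer. -/
def mixerEigenvalue {n : ℕ} (z : Bits n) : ℂ := ∑ j, if z j then -1 else 1

lemma sum_bits_prod {n : ℕ} (f : Fin n → Bool → ℂ) :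
    ∑ z : Bits n, ∏ j, f j (z j) = ∏ j, (f j false + f j true) := by
  have h := Finset.prod_univ_sum (fun _ : Fin n => (Finset.univ : Finset Bool)) f
  rw [Fintype.piFinset_univ] at h
  rw [← h]
  exact Finset.prod_congr rfl fun j _ => by rw [Fintype.sum_bool, add_comm]

lemma walsh_mul_walsh (n : ℕ) : walsh n * walsh n = (2 : ℂ) ^ n • 1 := by
  ext x y
  simp only [walsh, Matrix.mul_apply, Matrix.of_apply, ← Finset.prod_mul_distrib]
  rw [sum_bits_prod fun j b => (if x j && b then -1 else 1) * (if b && y j then -1 else 1)]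
  by_cases h : x = y
  · subst h
    have : ∀ j, ((if x j && false then (-1 : ℂ) else 1) * (if false && x j then -1 else 1) +
        (if x j && true then (-1 : ℂ) else 1) * (if true && x j then -1 else 1)) = 2 := by
      intro j
      cases x j <;> norm_num
    rw [Finset.prod_congr rfl fun j _ => this j]
    simp
  · obtain ⟨j, hj⟩ := Function.ne_iff.mp h
    rw [Finset.prod_eq_zero (Finset.mem_univ j)]
    · simp [Matrix.one_apply_ne h]
    · revert hj
      cases x j <;> cases y j <;> norm_num

/-- The columns of the Walsh matrix are the characters of the group of bit strings. Flipping bit `j`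
multiplies the character `z` by `(-1)^{z_j}`, so the characters diagonalise all `X_j` at once. -/
lemma pauliX_mul_walsh {n : ℕ} (j : Fin n) (x z : Bits n) :
    (pauliX j * walsh n) x z = (if z j then -1 else 1) * walsh n x z := by
  have hflip : ∀ y : Bits n, x = Function.update y j (!(y j)) ↔
      y = Function.update x j (!(x j)) := by
    intro y
    constructor <;> rintro rfl <;> simp
  have happ : (pauliX j * walsh n) x z = walsh n (Function.update x j (!(x j))) z := by
    simp only [pauliX, Matrix.mul_apply, Matrix.of_apply, hflip, ite_mul, one_mul, zero_mul,
      Finset.sum_ite_eq', Finset.mem_univ, if_true]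
  rw [happ]
  simp only [walsh, Matrix.of_apply]
  rw [← Finset.mul_prod_erase _ _ (Finset.mem_univ j),
    ← Finset.mul_prod_erase (a := j) (f := fun i => if x i && z i then (-1 : ℂ) else 1) _
      (Finset.mem_univ j), ← mul_assoc]
  refine congrArg₂ (fun u v : ℂ => u * v) ?_ ?_
  · rw [Function.update_self]
    cases x j <;> cases z j <;> norm_num
  · refine Finset.prod_congr rfl fun i hi => ?_
    rw [Function.update_of_ne (Finset.ne_of_mem_erase hi)]

lemma mixer_mul_walsh (n : ℕ) :
    mixer n * walsh n = walsh n * Matrix.diagonal mixerEigenvalue := by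
  ext x z
  rw [mixer, Finset.sum_mul, Matrix.sum_apply, Matrix.mul_diagonal]
  simp only [pauliX_mul_walsh, mixerEigenvalue, ← Finset.sum_mul]
  ring

lemma walsh_mul_inv (n : ℕ) : walsh n * (((2 : ℂ) ^ n)⁻¹ • walsh n) = 1 := by
  rw [Matrix.mul_smul, walsh_mul_walsh, smul_smul, inv_mul_cancel₀ (pow_ne_zero _ two_ne_zero), one_smul]

lemma exp_smul_mixer (n : ℕ) (t : ℂ) :
    NormedSpace.exp (t • mixer n) =
      walsh n * Matrix.diagonal (fun z => Complex.exp (t * mixerEigenvalue z)) *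
        (((2 : ℂ) ^ n)⁻¹ • walsh n) := by
  have hinv : (walsh n)⁻¹ = ((2 : ℂ) ^ n)⁻¹ • walsh n := Matrix.inv_eq_right_inv (walsh_mul_inv n)
  have hunit : IsUnit (walsh n) :=
    (Matrix.isUnit_iff_isUnit_det _).2 (Matrix.isUnit_det_of_right_inverse (walsh_mul_inv n))
  have hconj : t • mixer n =
      walsh n * Matrix.diagonal (fun z => t * mixerEigenvalue z) * (walsh n)⁻¹ := by
    have hd : Matrix.diagonal (fun z : Bits n => t * mixerEigenvalue z)
        = t • Matrix.diagonal mixerEigenvalue := by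
      rw [← Matrix.diagonal_smul]; rfl
    rw [hd, Matrix.mul_smul, ← mixer_mul_walsh, Matrix.smul_mul, Matrix.mul_assoc, hinv,
      walsh_mul_inv, Matrix.mul_one]
  rw [hconj, Matrix.exp_conj _ _ hunit, Matrix.exp_diagonal, hinv]
  congr 3
  ext z
  rw [Pi.coe_exp, Complex.exp_eq_exp_ℂ]

/-- In the Walsh basis the sum over characters factors over the bits, and each factor is `(e^{iβ} ±
e^{-iβ})/2`, with the plus sign when the two bits agree. -/
lemma exp_mixer_apply {n : ℕ} (β : ℝ) (x y : Bits n) :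
    NormedSpace.exp ((Complex.I * (β : ℂ)) • mixer n) x y =
      ∏ j, if x j = y j then Complex.cos β else Complex.I * Complex.sin β := by
  rw [exp_smul_mixer, Matrix.mul_apply]
  simp only [Matrix.mul_diagonal, Matrix.smul_apply, smul_eq_mul, walsh, Matrix.of_apply,
    mixerEigenvalue, Finset.mul_sum, Complex.exp_sum]
  have : ∀ z : Bits n, (∏ j, if x j && z j then (-1 : ℂ) else 1) *
      (∏ j, Complex.exp (Complex.I * β * if z j then -1 else 1)) *
      (((2 : ℂ) ^ n)⁻¹ * ∏ j, if z j && y j then (-1 : ℂ) else 1) =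
      ∏ j, ((2 : ℂ)⁻¹ * ((if x j && z j then (-1 : ℂ) else 1) *
        Complex.exp (Complex.I * β * if z j then -1 else 1) *
        if z j && y j then (-1 : ℂ) else 1)) := by
    intro z
    simp only [Finset.prod_mul_distrib, Finset.prod_const, Finset.card_univ, Fintype.card_fin,
      inv_pow]
    ring
  simp only [this]
  rw [sum_bits_prod fun j b => (2 : ℂ)⁻¹ * ((if x j && b then (-1 : ℂ) else 1) *
        Complex.exp (Complex.I * β * if b then -1 else 1) *
        if b && y j then (-1 : ℂ) else 1)]
  refine Finset.prod_congr rfl fun j _ => ?_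
  have h1 : Complex.exp (Complex.I * β) = Complex.cos β + Complex.sin β * Complex.I := by
    rw [mul_comm, Complex.exp_mul_I]
  have h2 : Complex.exp (-(Complex.I * β)) = Complex.cos β - Complex.sin β * Complex.I := by
    rw [mul_comm, ← neg_mul, Complex.exp_mul_I, Complex.cos_neg, Complex.sin_neg]
    ring
  cases x j <;> cases y j <;> simp [h1, h2] <;> ring

/-! ### Amplitudes of symmetric cost functions -/

/-- The string that differs from `s` exactly in the bits of `T`. -/
def flipSet {n : ℕ} (s : Bits n) (T : Finset (Fin n)) : Bits n :=
  bitXor (fun i => decide (i ∈ T)) s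

lemma sum_bits_eq_sum_flipSet {n : ℕ} (s : Bits n) (F : Bits n → ℂ) :
    ∑ x, F x = ∑ T : Finset (Fin n), F (flipSet s T) := by
  symm
  refine Fintype.sum_bijective (flipSet s) ⟨fun T T' h => ?_, fun x => ?_⟩ _ _ fun _ => rfl
  · ext i
    have := congrFun h i
    simpa [flipSet, bitXor] using this
  · refine ⟨Finset.univ.filter fun i => x i ≠ s i, ?_⟩
    ext i
    simp only [flipSet, bitXor, Finset.mem_filter, Finset.mem_univ, true_and]
    cases x i <;> cases s i <;> simp

lemma eq_of_card_eq {n : ℕ} {s : Bits n} {C : Bits n → ℤ}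
    (hC : IsSymmetricRel (⊤ : Subgroup (Equiv.Perm (Fin n))) s C) {T T' : Finset (Fin n)}
    (h : T.card = T'.card) : C (flipSet s T) = C (flipSet s T') := by
  -- The map goes from `T'` to `T` because permutations act on strings by precomposition; it extends
  -- to a permutation of all positions.
  have e : {i // i ∈ T'} ≃ {i // i ∈ T} := Finset.equivOfCardEq h.symm
  have := hC e.extendSubtype trivial (flipSet s T)
  rw [← this]
  congr 1
  ext i
  have hi : e.extendSubtype i ∈ T ↔ i ∈ T' :=
    ⟨fun hi => by_contra fun hn => e.extendSubtype_not_mem i hn hi, e.extendSubtype_mem i⟩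
  simp [flipSet, bitXor, permuteBits, hi]

lemma cost_flipSet {n : ℕ} {s : Bits n} {C : Bits n → ℤ}
    (hC : IsSymmetricRel (⊤ : Subgroup (Equiv.Perm (Fin n))) s C) (T : Finset (Fin n)) :
    C (flipSet s T) = costAtDistance s C T.card := by
  have hT : T.card ≤ n := by simpa using T.card_le_univ
  have hcard : (Finset.univ.filter fun i : Fin n => (i : ℕ) < T.card).card = T.card := by
    rw [Fin.card_filter_val_lt, min_eq_right hT]
  rw [eq_of_card_eq hC hcard.symm, costAtDistance]
  congr 1
  simp [flipSet, flipFirst]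

lemma qaoaState_apply_self {n : ℕ} {s : Bits n} {C : Bits n → ℤ}
    (hC : IsSymmetricRel (⊤ : Subgroup (Equiv.Perm (Fin n))) s C) (γ β : ℝ) :
    qaoaState C γ β s = ∑ k ∈ Finset.range (n + 1), (n.choose k : ℂ) *
      (Complex.cos β ^ (n - k) * (Complex.I * Complex.sin β) ^ k *
        Complex.exp (Complex.I * (γ * costAtDistance s C k)) * ((√(2 ^ n))⁻¹ : ℝ)) := by
  have hdiag : NormedSpace.exp ((Complex.I * (γ : ℂ)) • costOperator C) =
      Matrix.diagonal fun x => Complex.exp (Complex.I * (γ * C x)) := by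
    have : (Complex.I * (γ : ℂ)) • costOperator C =
        Matrix.diagonal fun x => Complex.I * (γ * C x) := by
      rw [costOperator, ← Matrix.diagonal_smul]
      congr 1
      ext x
      simp [mul_assoc]
    rw [this, Matrix.exp_diagonal]
    congr 1
    ext x
    rw [Pi.coe_exp, Complex.exp_eq_exp_ℂ]
  rw [qaoaState, hdiag, Matrix.mulVec, dotProduct]
  simp only [Matrix.mulVec_diagonal, exp_mixer_apply, plusState]
  rw [sum_bits_eq_sum_flipSet s]
  simp only [cost_flipSet hC]
  have hprod : ∀ T : Finset (Fin n),
      (∏ j, if s j = flipSet s T j then Complex.cos β else Complex.I * Complex.sin β) =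
      Complex.cos β ^ (n - T.card) * (Complex.I * Complex.sin β) ^ T.card := by
    intro T
    have hj : ∀ j, s j = flipSet s T j ↔ ¬ j ∈ T := by
      intro j
      simp only [flipSet, bitXor]
      by_cases h : j ∈ T <;> cases s j <;> simp [h]
    simp only [hj]
    rw [Finset.prod_ite, Finset.prod_const, Finset.prod_const]
    congr 2
    · rw [← Finset.compl_filter]
      simp [Finset.card_compl]
    · simp
  simp only [hprod]
  rw [← Finset.powerset_univ, Finset.sum_powerset_apply_card (fun k => Complex.cos β ^ (n - k) *
    (Complex.I * Complex.sin β) ^ k * (Complex.exp (Complex.I * (γ * costAtDistance s C k)) *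
      ((√(2 ^ n))⁻¹ : ℝ)))]
  simp only [Finset.card_univ, Fintype.card_fin, nsmul_eq_mul, mul_assoc]

/-! ### The normal limit of binomial sums -/

/-- The weights of the binomial distribution with success probability `1/2`. -/
noncomputable def binomWeight (n k : ℕ) : ℝ := n.choose k / 2 ^ n

/-- The number of successes `k` out of `n`, centred and scaled to unit variance. -/
noncomputable def stdScore (n k : ℕ) : ℝ := (2 * k - n) / √n

lemma binomWeight_nonneg (n k : ℕ) : 0 ≤ binomWeight n k := by
  unfold binomWeight; positivity

lemma sum_binomWeight (n : ℕ) : ∑ k ∈ Finset.range (n + 1), binomWeight n k = 1 := by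
  simp only [binomWeight]
  rw [← Finset.sum_div, ← Nat.cast_sum, Nat.sum_range_choose]
  simp

/-- The Bernstein polynomials at `1/2` are the binomial weights, so this is their variance identity
rescaled by `4/n`. It supplies the Chebyshev-type tail bound below. -/
lemma sum_binomWeight_mul_stdScore_sq {n : ℕ} (hn : 0 < n) :
    ∑ k ∈ Finset.range (n + 1), binomWeight n k * stdScore n k ^ 2 = 1 := by
  have h := congrArg (Polynomial.eval (2⁻¹ : ℝ)) (bernsteinPolynomial.variance ℝ n)
  rw [Polynomial.eval_finsetSum] at h
  have hn' : (0 : ℝ) < n := Nat.cast_pos.2 hn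
  have hterm : ∀ k ∈ Finset.range (n + 1), binomWeight n k * stdScore n k ^ 2 =
      4 / n * Polynomial.eval (2⁻¹ : ℝ)
        ((n • Polynomial.X - (k : Polynomial ℝ)) ^ 2 * bernsteinPolynomial ℝ n k) := by
    intro k hk
    have hkn : k ≤ n := Nat.lt_succ_iff.1 (Finset.mem_range.1 hk)
    have hpow : (2 : ℝ)⁻¹ ^ k * 2⁻¹ ^ (n - k) = (2 ^ n)⁻¹ := by
      rw [← pow_add, Nat.add_sub_cancel' hkn, inv_pow]
    have h1 : (1 - 2⁻¹ : ℝ) = 2⁻¹ := by norm_num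
    simp only [bernsteinPolynomial, Polynomial.eval_mul, Polynomial.eval_pow,
      Polynomial.eval_sub, Polynomial.eval_natCast, Polynomial.eval_X,
      Polynomial.eval_one, nsmul_eq_mul, h1, mul_assoc, hpow]
    rw [binomWeight, stdScore, div_pow, Real.sq_sqrt hn'.le]
    field_simp
    ring
  rw [Finset.sum_congr rfl hterm, ← Finset.mul_sum, h]
  simp only [nsmul_eq_mul, Polynomial.eval_mul, Polynomial.eval_natCast, Polynomial.eval_X,
    Polynomial.eval_sub, Polynomial.eval_one]
  field_simp
  norm_num

open MeasureTheory ProbabilityTheory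

/-- The law of the standardised number of successes in `n` fair coin flips. -/
noncomputable def stdBinomial (n : ℕ) : Measure ℝ :=
  ∑ k ∈ Finset.range (n + 1), ENNReal.ofReal (binomWeight n k) • Measure.dirac (stdScore n k)

instance isProbabilityMeasure_stdBinomial (n : ℕ) : IsProbabilityMeasure (stdBinomial n) := by
  constructor
  simp only [stdBinomial, Measure.coe_finsetSum, Finset.sum_apply, Measure.smul_apply,
    measure_univ, smul_eq_mul, mul_one]
  rw [← ENNReal.ofReal_sum_of_nonneg fun k _ => binomWeight_nonneg n k, sum_binomWeight,
    ENNReal.ofReal_one]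

lemma integral_stdBinomial {E : Type*} [NormedAddCommGroup E] [NormedSpace ℝ E] [CompleteSpace E]
    (n : ℕ) (f : ℝ → E) :
    ∫ x, f x ∂stdBinomial n =
      ∑ k ∈ Finset.range (n + 1), binomWeight n k • f (stdScore n k) := by
  rw [stdBinomial, integral_finsetSum_measure]
  · refine Finset.sum_congr rfl fun k _ => ?_
    rw [integral_smul_measure, integral_dirac, ENNReal.toReal_ofReal (binomWeight_nonneg n k)]
  · intro k _
    exact (integrable_dirac (by simp)).smul_measure ENNReal.ofReal_ne_top

/-- Binomial expansion of `((e^{iv} + e^{-iv})/2)^n` with `v = t/√n`. -/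
lemma charFun_stdBinomial (n : ℕ) (t : ℝ) :
    charFun (stdBinomial n) t = Complex.cos (((√n)⁻¹ * t : ℝ)) ^ n := by
  rw [charFun_apply_real, integral_stdBinomial, Complex.cos, div_pow, add_pow, Finset.sum_div]
  refine Finset.sum_congr rfl fun k hk => ?_
  have hkn : k ≤ n := Nat.lt_succ_iff.1 (Finset.mem_range.1 hk)
  rw [← Complex.exp_nat_mul, ← Complex.exp_nat_mul, ← Complex.exp_add, binomWeight, stdScore,
    Nat.cast_sub hkn, Complex.real_smul, mul_comm (Complex.exp _)]
  push_cast
  rw [div_mul_eq_mul_div]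
  congr 3
  ring

lemma tendsto_charFun_stdBinomial (t : ℝ) :
    Tendsto (fun n => charFun (stdBinomial n) t) atTop (𝓝 (charFun (gaussianReal 0 1) t)) := by
  have hscore : stdScore 1 0 = -1 ∧ stdScore 1 1 = 1 := by
    constructor <;> norm_num [stdScore]
  -- For `n = 1` the law is a fair sign, centred with unit variance; the characteristic function for
  -- general `n` is the `n`-th power of its rescaled one.
  have h := tendsto_charFun_inv_sqrt_mul_pow (P := stdBinomial 1) (X := id) aemeasurable_id
    (by rw [integral_stdBinomial]; simp [Finset.sum_range_succ, hscore, binomWeight])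
    (by rw [integral_stdBinomial]; norm_num [Finset.sum_range_succ, hscore, binomWeight]) t
  rw [Measure.map_id] at h
  have hlim : charFun (gaussianReal 0 1) t = Complex.exp (-t ^ 2 / 2) := by
    rw [charFun_gaussianReal]
    simp [neg_div]
  rw [hlim]
  refine h.congr fun n => ?_
  rw [charFun_stdBinomial, charFun_stdBinomial]
  simp

lemma tendsto_integral_stdBinomial {g : ℝ → ℂ} (hg : Continuous g) {K : ℝ}
    (hK : ∀ x, ‖g x‖ ≤ K) :
    Tendsto (fun n => ∑ k ∈ Finset.range (n + 1), binomWeight n k * g (stdScore n k)) atTop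
      (𝓝 (∫ x, g x ∂gaussianReal 0 1)) := by
  have hweak : Tendsto (β := ProbabilityMeasure ℝ) (fun n => ⟨stdBinomial n, inferInstance⟩) atTop
      (𝓝 ⟨gaussianReal 0 1, inferInstance⟩) :=
    ProbabilityMeasure.tendsto_iff_tendsto_charFun.2 tendsto_charFun_stdBinomial
  have := (ProbabilityMeasure.tendsto_iff_forall_integral_rclike_tendsto ℂ).1 hweak
    (BoundedContinuousFunction.ofNormedAddCommGroup g hg K hK)
  refine this.congr fun n => ?_
  simp [integral_stdBinomial]

/-- Binomial averages of functions that are close to a fixed bounded continuous function of the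
standard score on its compact subsets. -/
lemma tendsto_binomial_average {g : ℝ → ℂ} (hg : Continuous g) (hg1 : ∀ x, ‖g x‖ ≤ 1)
    {F : ℕ → ℕ → ℂ} (hF : ∀ n k, ‖F n k‖ ≤ 1)
    (h : ∀ M : ℝ, 0 < M → ∀ ε : ℝ, 0 < ε → ∀ᶠ n : ℕ in atTop, ∀ k ≤ n, |stdScore n k| ≤ M →
      ‖F n k - g (stdScore n k)‖ ≤ ε) :
    Tendsto (fun n => ∑ k ∈ Finset.range (n + 1), binomWeight n k * F n k) atTop
      (𝓝 (∫ x, g x ∂gaussianReal 0 1)) := by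
  have hdiff : Tendsto (fun n => ∑ k ∈ Finset.range (n + 1), binomWeight n k * F n k -
      ∑ k ∈ Finset.range (n + 1), binomWeight n k * g (stdScore n k)) atTop (𝓝 0) := by
    rw [NormedAddGroup.tendsto_nhds_zero]
    intro ε hε
    have hsε : 0 < √ε := Real.sqrt_pos.2 hε
    -- Beyond the cutoff `4/√ε` one has `z² ≥ 16/ε`, so the trivial bound `2` on the difference is
    -- at most `(ε/8)z²`. As the second moment is `1`, the total error is at most `5ε/8`.
    filter_upwards [h (4 / √ε) (by positivity) (ε / 2) (by positivity), eventually_gt_atTop 0]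
      with n hn hn0
    have hterm : ∀ k ∈ Finset.range (n + 1),
        ‖(binomWeight n k : ℂ) * F n k - binomWeight n k * g (stdScore n k)‖ ≤
          binomWeight n k * (ε / 2) + ε / 8 * (binomWeight n k * stdScore n k ^ 2) := by
      intro k hk
      have hkn : k ≤ n := Nat.lt_succ_iff.1 (Finset.mem_range.1 hk)
      have hw := binomWeight_nonneg n k
      rw [← mul_sub, norm_mul, Complex.norm_real, Real.norm_of_nonneg hw]
      have hmain : ‖F n k - g (stdScore n k)‖ ≤ ε / 2 + ε / 8 * stdScore n k ^ 2 := by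
        by_cases hM : |stdScore n k| ≤ 4 / √ε
        · exact (hn k hkn hM).trans (le_add_of_nonneg_right (by positivity))
        · have hsq : (4 / √ε) ^ 2 ≤ stdScore n k ^ 2 := by
            rw [← sq_abs (stdScore n k)]
            exact pow_le_pow_left₀ (by positivity) (not_le.1 hM).le 2
          rw [div_pow, Real.sq_sqrt hε.le, div_le_iff₀ hε] at hsq
          have h2 := (norm_sub_le (F n k) (g (stdScore n k))).trans
            (add_le_add (hF n k) (hg1 (stdScore n k)))
          linarith
      nlinarith
    rw [← Finset.sum_sub_distrib]
    refine ((norm_sum_le _ _).trans (Finset.sum_le_sum hterm)).trans_lt ?_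
    rw [Finset.sum_add_distrib, ← Finset.sum_mul, ← Finset.mul_sum, sum_binomWeight,
      sum_binomWeight_mul_stdScore_sq hn0]
    linarith
  simpa using hdiff.add (tendsto_integral_stdBinomial hg hg1)

lemma norm_sq_integral_gaussianReal_exp_sq (θ : ℝ) :
    ‖∫ x, Complex.exp (Complex.I * (θ * x ^ 2 : ℝ)) ∂gaussianReal 0 1‖ ^ 2 =
      (1 + 4 * θ ^ 2) ^ (-(1 / 2) : ℝ) := by
  rw [integral_gaussianReal_eq_integral_smul one_ne_zero]
  have hb : 0 < ((1 : ℂ) / 2 - Complex.I * θ).re := by simp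
  have hint : ∀ x : ℝ, gaussianPDFReal 0 1 x • Complex.exp (Complex.I * (θ * x ^ 2 : ℝ)) =
      ((√(2 * Real.pi))⁻¹ : ℝ) * Complex.exp (-((1 : ℂ) / 2 - Complex.I * θ) * x ^ 2) := by
    intro x
    rw [gaussianPDFReal, Complex.real_smul]
    push_cast
    rw [mul_assoc, ← Complex.exp_add]
    congr 2
    · simp
    · simp; ring
  simp only [hint]
  rw [integral_const_mul, integral_gaussian_complex hb, norm_mul, mul_pow, Complex.norm_real,
    Real.norm_of_nonneg (by positivity), inv_pow, Real.sq_sqrt (by positivity),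
    ← norm_pow]
  -- Squaring removes the complex square root, so only a modulus is needed and no branch has to be
  -- tracked.
  have hsq : (((Real.pi : ℂ) / ((1 : ℂ) / 2 - Complex.I * θ)) ^ (1 / 2 : ℂ)) ^ 2 =
      (Real.pi : ℂ) / ((1 : ℂ) / 2 - Complex.I * θ) := by
    rw [← Complex.cpow_nat_mul]
    norm_num
  rw [hsq, norm_div, Complex.norm_real, Real.norm_of_nonneg Real.pi_pos.le]
  have hnorm : ‖(1 : ℂ) / 2 - Complex.I * θ‖ = √(1 + 4 * θ ^ 2) / 2 := by
    rw [Complex.norm_eq_sqrt_sq_add_sq]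
    have h4 : (1 + 4 * θ ^ 2) = 2 ^ 2 * (1 / 4 + θ ^ 2) := by ring
    rw [h4, Real.sqrt_mul (by norm_num), Real.sqrt_sq (by norm_num)]
    simp
    norm_num
  rw [hnorm, Real.rpow_neg (by positivity), ← Real.sqrt_eq_rpow]
  have := Real.pi_pos
  have : 0 < √(1 + 4 * θ ^ 2) := Real.sqrt_pos.2 (by positivity)
  field_simp

/-! ### Bounded locality makes the remainder regular -/

/-- Pair each `T` not containing `i` with `T ∪ {i}`: the values of `f` agree and the signs are
opposite. -/
lemma alternating_sum_flipSet_eq_zero {n : ℕ} {S U : Finset (Fin n)} {f : Bits n → ℤ}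
    (hf : DependsOn f (S : Set (Fin n))) {i : Fin n} (hiU : i ∈ U) (hiS : i ∉ S) (s : Bits n) :
    ∑ T ∈ U.powerset, (-1) ^ T.card * f (flipSet s T) = 0 := by
  rw [← Finset.insert_erase hiU, Finset.sum_powerset_insert (Finset.notMem_erase i U),
    ← Finset.sum_add_distrib]
  refine Finset.sum_eq_zero fun T hT => ?_
  have hiT : i ∉ T := fun h => Finset.notMem_erase i U (Finset.mem_powerset.1 hT h)
  have : f (flipSet s (insert i T)) = f (flipSet s T) := by
    refine hf fun j hj => ?_
    have hji : j ≠ i := fun h => hiS (h ▸ hj)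
    simp [flipSet, bitXor, hji]
  rw [this, Finset.card_insert_of_notMem hiT, pow_succ]
  ring

/-- A set `U` of `j > q` positions contains one that a given clause ignores, so the alternating sum
of every clause over subsets of `U` vanishes. Grouped by cardinality, the sum for `C` is `±Δ^j
c(0)`. The bound `j ≤ n` is what lets `U` exist. -/
lemma fwdDiff_iter_cost_eq_zero {n q j : ℕ} {s : Bits n} {C : Bits n → ℤ}
    (hC : IsSymmetricRel (⊤ : Subgroup (Equiv.Perm (Fin n))) s C) (hq : IsLocalCSP q C)
    (hqj : q < j) (hjn : j ≤ n) : (fwdDiff 1)^[j] (costAtDistance s C) 0 = 0 := by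
  obtain ⟨m, S, clause, hcard, hdep, hsum⟩ := hq
  obtain ⟨U, -, hU⟩ := Finset.exists_subset_card_eq (s := (Finset.univ : Finset (Fin n)))
    (n := j) (by simpa using hjn)
  have hzero : ∑ T ∈ U.powerset, (-1) ^ T.card * C (flipSet s T) = 0 := by
    simp only [hsum, Finset.mul_sum]
    rw [Finset.sum_comm]
    refine Finset.sum_eq_zero fun α _ => ?_
    obtain ⟨i, hiU, hiS⟩ := Finset.exists_mem_notMem_of_card_lt_card
      (show (S α).card < U.card by rw [hU]; exact (hcard α).trans_lt hqj)
    exact alternating_sum_flipSet_eq_zero (hdep α) hiU hiS s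
  simp only [cost_flipSet hC] at hzero
  rw [Finset.sum_powerset_apply_card (fun k => (-1) ^ k * costAtDistance s C k), hU] at hzero
  rw [fwdDiff_iter_eq_sum_shift]
  have hterm : ∀ k ∈ Finset.range (j + 1),
      ((-1 : ℤ) ^ (j - k) * j.choose k) • costAtDistance s C (0 + k • 1) =
        (-1) ^ j * (j.choose k • ((-1) ^ k * costAtDistance s C k)) := by
    intro k hk
    have hkj : k ≤ j := Nat.lt_succ_iff.1 (Finset.mem_range.1 hk)
    have hsign : (-1 : ℤ) ^ (j - k) = (-1) ^ j * (-1) ^ k := by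
      conv_rhs => rw [← Nat.sub_add_cancel hkj, pow_add, mul_assoc, ← pow_add, ← two_mul]
      simp
    simp only [hsign, smul_eq_mul, mul_one, zero_add, nsmul_eq_mul]
    ring
  rw [Finset.sum_congr rfl hterm, ← Finset.mul_sum, hzero, mul_zero]

open Polynomial in
lemma exists_polynomial_cost {n q : ℕ} {s : Bits n} {C : Bits n → ℤ}
    (hC : IsSymmetricRel (⊤ : Subgroup (Equiv.Perm (Fin n))) s C) (hq : IsLocalCSP q C) :
    ∃ p : ℝ[X], p.natDegree ≤ q ∧ ∀ k ≤ n, p.eval (k : ℝ) = costAtDistance s C k := by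
  set d : ℕ → ℤ := fun j => (fwdDiff 1)^[j] (costAtDistance s C) 0 with hd
  refine ⟨∑ j ∈ Finset.range (q + 1), Polynomial.C (d j / j.factorial : ℝ) * descPochhammer ℝ j,
    natDegree_sum_le_of_forall_le _ _ fun j hj => ?_, fun k hk => ?_⟩
  · exact (natDegree_C_mul_le _ _).trans
      ((descPochhammer_natDegree ℝ j).le.trans (Nat.lt_succ_iff.1 (Finset.mem_range.1 hj)))
  · have hnewton := shift_eq_sum_fwdDiff_iter 1 (costAtDistance s C) k 0
    -- Newton's formula stops at `k`, the polynomial at `q`. Extending both to `max k q` adds only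
    -- zeros: binomial coefficients with `j > k`, or differences with `q < j ≤ k ≤ n`.
    have hcommon : ∑ j ∈ Finset.range (k + 1), k.choose j • d j =
        ∑ j ∈ Finset.range (q + 1), k.choose j • d j := by
      have hle : ∀ m, k ≤ m ∨ q ≤ m → m ≤ max k q → ∑ j ∈ Finset.range (m + 1), k.choose j • d j =
          ∑ j ∈ Finset.range (max k q + 1), k.choose j • d j := by
        intro m hm hmax
        refine Finset.sum_subset (Finset.range_mono (by lia)) fun j hj hj' => ?_
        rw [Finset.mem_range] at hj hj'
        by_cases hjk : k < j
        · rw [Nat.choose_eq_zero_of_lt hjk, zero_smul]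
        · rw [hd]
          simp only
          rw [fwdDiff_iter_cost_eq_zero hC hq (by lia) (by lia), smul_zero]
      rw [hle k (.inl le_rfl) (le_max_left _ _), hle q (.inr le_rfl) (le_max_right _ _)]
    rw [hcommon] at hnewton
    simp only [smul_eq_mul, mul_one, zero_add] at hnewton
    rw [hnewton, eval_finsetSum]
    push_cast
    refine Finset.sum_congr rfl fun j _ => ?_
    rw [nsmul_eq_mul, eval_mul, eval_C, Int.cast_mul, Int.cast_natCast,
      Nat.cast_choose_eq_descPochhammer_div]
    ring

open Polynomial in
lemma exists_polynomial_costRemainder {n q ℓ a : ℕ} (ha : a ≤ ℓ) {s : Bits n} {C : Bits n → ℤ}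
    (hC : IsSymmetricRel (⊤ : Subgroup (Equiv.Perm (Fin n))) s C) (hq : IsLocalCSP q C) :
    ∃ p : ℝ[X], p.natDegree ≤ max q ℓ ∧ ∀ k ≤ n, p.eval (k : ℝ) = costRemainder ℓ a s C k := by
  obtain ⟨p, hp, heval⟩ := exists_polynomial_cost hC hq
  set X' : ℝ[X] := Polynomial.C (n : ℝ)⁻¹ * X with hX'
  have hdeg : X'.natDegree ≤ 1 := (natDegree_C_mul_le _ _).trans natDegree_X_le
  have hdeg' : (1 - X').natDegree ≤ 1 := by
    refine (natDegree_sub_le _ _).trans (max_le ?_ hdeg)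
    simp
  refine ⟨p - Polynomial.C ((n : ℝ) ^ ℓ) * X' ^ a * (1 - X') ^ (ℓ - a), ?_, fun k hk => ?_⟩
  · refine (natDegree_sub_le _ _).trans (max_le_max hp ?_)
    have h := natDegree_mul_le_of_le ((natDegree_C_mul_le ((n : ℝ) ^ ℓ) _).trans
      (natDegree_pow_le_of_le a hdeg)) (natDegree_pow_le_of_le (ℓ - a) hdeg')
    lia
  · simp only [eval_sub, heval k hk, eval_mul, eval_C, eval_pow, hX', eval_X, eval_one,
      costRemainder]
    simp only [div_eq_inv_mul]

open Polynomial in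
/-- Polynomials of degree at most `D` that are bounded by `R` on `{0, …, n}` have, after rescaling
to the unit interval, a modulus of continuity depending only on `D` and `R`. -/
lemma exists_modulus_of_bounded_on_grid {D : ℕ} (hD : 0 < D) {ε : ℝ} (hε : 0 < ε) :
    ∃ δ : ℝ, 0 < δ ∧ ∀ n : ℕ, D ≤ n → ∀ p : ℝ[X], p.natDegree ≤ D → ∀ R : ℝ,
      (∀ k ≤ n, |p.eval (k : ℝ)| ≤ R) → ∀ x ∈ Set.Icc (0 : ℝ) n, ∀ y ∈ Set.Icc (0 : ℝ) n,
      |x - y| ≤ δ * n → |p.eval x - p.eval y| ≤ ε * R := by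
  -- The Lagrange basis at the nodes `0, …, D` does not depend on `n` or `p`, so its modulus of
  -- continuity on `[0, 2D]` serves for all of them.
  set L : ℕ → ℝ[X] := Lagrange.basis (Finset.range (D + 1)) (fun i : ℕ => (i : ℝ))
  have hcont : Continuous fun (x : ℝ) (j : Fin (D + 1)) => (L j).eval x :=
    continuous_pi fun j => (L j).continuous
  obtain ⟨δ, hδ, hL⟩ := Metric.uniformContinuousOn_iff.1
    ((isCompact_Icc (a := (0 : ℝ)) (b := 2 * D)).uniformContinuousOn_of_continuous
      hcont.continuousOn) (ε / (D + 1)) (by positivity)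
  have hD' : (0 : ℝ) < D := Nat.cast_pos.2 hD
  refine ⟨δ / (4 * D), by positivity, fun n hn p hp R hR x hx y hy hxy => ?_⟩
  -- With mesh `h` the nodes `hj`, `j ≤ D`, stay in the grid where `p` is bounded. Rounding down
  -- costs at most a factor two, `n ≤ 2Dh`, hence the interval `[0, 2D]` and the constant `δ/(4D)`.
  set h : ℕ := n / D
  have hh : 0 < h := Nat.div_pos hn hD
  have hh' : (0 : ℝ) < h := Nat.cast_pos.2 hh
  have hDh : D * h ≤ n := Nat.mul_div_le n D
  have hnh : (n : ℝ) ≤ 2 * D * h := by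
    have h1 : n < D * (h + 1) := Nat.lt_mul_div_succ n hD
    have h2 : n ≤ 2 * D * h := by nlinarith
    exact_mod_cast h2
  have hR0 : 0 ≤ R := (abs_nonneg _).trans (hR 0 (Nat.zero_le n))
  have hscale : ∀ z ∈ Set.Icc (0 : ℝ) n, z / h ∈ Set.Icc (0 : ℝ) (2 * D) := fun z hz =>
    ⟨div_nonneg hz.1 hh'.le, (div_le_iff₀ hh').2 (hz.2.trans hnh)⟩
  have hinterp : ∀ z : ℝ, p.eval z =
      ∑ j ∈ Finset.range (D + 1), p.eval ((h * j : ℕ) : ℝ) * (L j).eval (z / h) := by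
    intro z
    have hdeg : (p.comp (Polynomial.C (h : ℝ) * X)).degree < (Finset.range (D + 1)).card := by
      rw [Finset.card_range]
      refine degree_le_natDegree.trans_lt (Nat.cast_lt.2 (Nat.lt_succ_of_le ?_))
      refine natDegree_comp_le.trans ?_
      exact (Nat.mul_le_mul hp ((natDegree_C_mul_le _ _).trans natDegree_X_le)).trans (mul_one D).le
    have := congrArg (eval (z / h)) (Lagrange.eq_interpolate
      (v := fun i : ℕ => (i : ℝ)) Nat.cast_injective.injOn hdeg)
    rw [Lagrange.interpolate_apply, eval_finsetSum] at this
    simp only [eval_mul, eval_C, eval_comp, eval_X, mul_div_cancel₀ z hh'.ne'] at this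
    rw [this]
    simp only [Nat.cast_mul, L]
  have hclose := hL _ (hscale x hx) _ (hscale y hy) (by
    rw [Real.dist_eq, ← sub_div, abs_div, abs_of_pos hh', div_lt_iff₀ hh']
    calc |x - y| ≤ δ / (4 * D) * n := hxy
      _ ≤ δ / (4 * D) * (2 * D * h) := by gcongr
      _ = δ / 2 * h := by field_simp; norm_num
      _ < δ * h := by gcongr; linarith)
  rw [hinterp x, hinterp y, ← Finset.sum_sub_distrib]
  have hterm : ∀ j ∈ Finset.range (D + 1), |p.eval ((h * j : ℕ) : ℝ) * (L j).eval (x / h) -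
      p.eval ((h * j : ℕ) : ℝ) * (L j).eval (y / h)| ≤ R * (ε / (D + 1)) := by
    intro j hj
    rw [← mul_sub, abs_mul]
    have hjD : j ≤ D := Nat.lt_succ_iff.1 (Finset.mem_range.1 hj)
    refine mul_le_mul (hR _ ?_) ?_ (abs_nonneg _) hR0
    · exact (Nat.mul_le_mul_left h hjD).trans (by rwa [mul_comm])
    · exact ((dist_le_pi_dist _ _ (⟨j, Finset.mem_range.1 hj⟩ : Fin (D + 1))).trans_lt hclose).le
  refine (Finset.abs_sum_le_sum_abs _ _).trans ((Finset.sum_le_sum hterm).trans_eq ?_)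
  rw [Finset.sum_const, Finset.card_range, nsmul_eq_mul]
  push_cast
  field_simp

lemma HasBoundedLocality.hasRegularRemainder {ℓ a : ℕ} (ha : a ≤ ℓ) {s : ∀ n : ℕ, Bits n}
    {C : ∀ n : ℕ, Bits n → ℤ}
    (hsymm : ∀ n : ℕ, IsSymmetricRel (⊤ : Subgroup (Equiv.Perm (Fin n))) (s n) (C n))
    (hform : HasLeadingForm ℓ a s C) (hloc : HasBoundedLocality C) :
    HasRegularRemainder ℓ a s C := by
  obtain ⟨q, hq⟩ := hloc
  obtain ⟨K, hK⟩ := hform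
  intro ε hε
  have hK' : 0 < |K| + 1 := by positivity
  -- The `+ 1` in the degree and in `|K| + 1` only ensure positivity. Two points within `δ/2` of the
  -- midpoint are within `δ` of each other.
  obtain ⟨δ, hδ, hmod⟩ := exists_modulus_of_bounded_on_grid (D := max q ℓ + 1) (Nat.succ_pos _)
    (div_pos hε hK')
  refine ⟨δ / 2, by positivity, ?_⟩
  filter_upwards [hq, hK, eventually_ge_atTop (max q ℓ + 1)] with n hqn hKn hn k k' hk hk' hkδ hkδ'
  obtain ⟨p, hp, heval⟩ := exists_polynomial_costRemainder ha (hsymm n) hqn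
  have hn0 : (0 : ℝ) < n := Nat.cast_pos.2 (by lia)
  have hpow : (0 : ℝ) < (n : ℝ) ^ ((ℓ : ℤ) - 1) := zpow_pos hn0 _
  have hbound : ∀ k ≤ n, |p.eval (k : ℝ)| ≤ (|K| + 1) * (n : ℝ) ^ ((ℓ : ℤ) - 1) := by
    intro k hk
    rw [heval k hk]
    exact (hKn k hk).trans (mul_le_mul_of_nonneg_right ((le_abs_self K).trans (by linarith))
      hpow.le)
  have hdist : |(k : ℝ) - k'| ≤ δ * n := by
    have h1 : |(k : ℝ) / n - k' / n| ≤ δ := by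
      rw [abs_le] at *
      constructor <;> linarith
    rwa [← sub_div, abs_div, abs_of_pos hn0, div_le_iff₀ hn0] at h1
  have := hmod n hn p (hp.trans (Nat.le_succ _)) _ hbound k
    ⟨Nat.cast_nonneg k, Nat.cast_le.2 hk⟩ k' ⟨Nat.cast_nonneg k', Nat.cast_le.2 hk'⟩ hdist
  rw [heval k hk, heval k' hk'] at this
  refine this.trans_eq ?_
  field_simp

/-! ### The phase near half the maximal distance -/

/-- Induction step for the expansion of `(1+u)^a (1-u)^b`. The factor `1 + τu` is at most `2` in
modulus, and the only cubic term it creates is `τβu³`, whence `2K + |β|`. -/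
lemma exists_taylor_bound_mul {f : ℝ → ℝ} {α β τ : ℝ} (hτ : |τ| = 1)
    (h : ∃ K : ℝ, ∀ u : ℝ, |u| ≤ 1 → |f u - (1 + α * u + β * u ^ 2)| ≤ K * |u| ^ 3) :
    ∃ K : ℝ, ∀ u : ℝ, |u| ≤ 1 →
      |f u * (1 + τ * u) - (1 + (α + τ) * u + (β + τ * α) * u ^ 2)| ≤ K * |u| ^ 3 := by
  obtain ⟨K, hK⟩ := h
  refine ⟨2 * K + |β|, fun u hu => ?_⟩
  have heq : f u * (1 + τ * u) - (1 + (α + τ) * u + (β + τ * α) * u ^ 2) =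
      (f u - (1 + α * u + β * u ^ 2)) * (1 + τ * u) + τ * (β * u ^ 3) := by ring
  have h2 : |1 + τ * u| ≤ 2 := by
    refine (abs_add_le _ _).trans ?_
    rw [abs_mul, hτ, abs_one]
    linarith
  rw [heq]
  refine (abs_add_le _ _).trans ?_
  rw [abs_mul, abs_mul τ, abs_mul β, hτ, abs_pow]
  have := mul_le_mul (hK u hu) h2 (abs_nonneg _) ((abs_nonneg _).trans (hK u hu))
  linarith

lemma exists_taylor_bound (a b : ℕ) :
    ∃ K : ℝ, ∀ u : ℝ, |u| ≤ 1 → |(1 + u) ^ a * (1 - u) ^ b -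
      (1 + ((a : ℝ) - b) * u + (((a : ℝ) - b) ^ 2 - (a + b)) / 2 * u ^ 2)| ≤ K * |u| ^ 3 := by
  induction a with
  | zero =>
    induction b with
    | zero => exact ⟨0, fun u _ => by simp⟩
    | succ b ih =>
      obtain ⟨K, hK⟩ := exists_taylor_bound_mul (τ := -1) (by simp) ih
      refine ⟨K, fun u hu => ?_⟩
      convert hK u hu using 2
      push_cast
      ring
  | succ a ih =>
    obtain ⟨K, hK⟩ := exists_taylor_bound_mul (τ := 1) (by simp) ih
    refine ⟨K, fun u hu => ?_⟩
    convert hK u hu using 2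
    push_cast
    ring

/-- The coefficient of the squared standard score in the phase. -/
noncomputable def phaseCoeff (ℓ a : ℕ) : ℝ :=
  Real.pi * (((ℓ : ℝ) - 2 * a) ^ 2 - ℓ) / (8 * ((ℓ : ℝ) - 2 * a))

/-- The phase of the strings at distance `k` from the planted one. -/
noncomputable def phase {n : ℕ} (ℓ a : ℕ) (s : Bits n) (C : Bits n → ℤ) (k : ℕ) : ℝ :=
  Real.pi / 2 * k + optGamma ℓ a n * costAtDistance s C k

/-- An exact identity. The linear Taylor term has coefficient `2a-ℓ`, so its prefactor turns it into
`-πnu/4`, which cancels the linear part of `πk/2 = πn/4 + πnu/4`. -/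
lemma phase_eq {ℓ a n k : ℕ} (ha : a ≤ ℓ) (hne : (ℓ : ℝ) - 2 * a ≠ 0) (hn : 0 < n)
    (s : Bits n) (C : Bits n → ℤ) {u : ℝ} (hu : u = stdScore n k / √n) :
    phase ℓ a s C k = Real.pi * n / (4 * ((ℓ : ℝ) - 2 * a)) + Real.pi * n / 4 +
      phaseCoeff ℓ a * stdScore n k ^ 2 +
      Real.pi * n / (4 * ((ℓ : ℝ) - 2 * a)) * ((1 + u) ^ a * (1 - u) ^ (ℓ - a) -
        (1 + ((a : ℝ) - (ℓ - a : ℕ)) * u +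
          (((a : ℝ) - (ℓ - a : ℕ)) ^ 2 - (a + (ℓ - a : ℕ))) / 2 * u ^ 2)) +
      optGamma ℓ a n * costRemainder ℓ a s C k := by
  have hn0 : (0 : ℝ) < n := Nat.cast_pos.2 hn
  have hs : √(n : ℝ) ^ 2 = n := Real.sq_sqrt hn0.le
  have hs0 : √(n : ℝ) ≠ 0 := (Real.sqrt_pos.2 hn0).ne'
  have hz : stdScore n k ^ 2 = n * u ^ 2 := by
    rw [hu, div_pow, hs]; field_simp
  have hu' : u = 2 * (k / n) - 1 := by
    rw [hu, stdScore, div_div, ← sq, hs]; field_simp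
  have hk : (k : ℝ) = n * (1 + u) / 2 := by
    rw [hu']; field_simp; ring
  have h1 : (k : ℝ) / n = (1 + u) / 2 := by rw [hu']; ring
  have h2 : 1 - (k : ℝ) / n = (1 - u) / 2 := by rw [hu']; ring
  have hcost : (costAtDistance s C k : ℝ) =
      n ^ ℓ * (2 ^ ℓ)⁻¹ * ((1 + u) ^ a * (1 - u) ^ (ℓ - a)) + costRemainder ℓ a s C k := by
    have hpow : (2 : ℝ) ^ ℓ = 2 ^ a * 2 ^ (ℓ - a) := by rw [← pow_add, Nat.add_sub_cancel' ha]
    rw [costRemainder, h2, h1, div_pow, div_pow, hpow]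
    field_simp
    ring
  have hγ : optGamma ℓ a n * (n ^ ℓ * (2 ^ ℓ)⁻¹) = Real.pi * n / (4 * ((ℓ : ℝ) - 2 * a)) := by
    rw [optGamma, zpow_sub₀ two_ne_zero, zpow_sub₀ hn0.ne', zpow_natCast, zpow_natCast]
    field_simp
    norm_num
  rw [phase, hcost, mul_add, ← mul_assoc, hγ, hz, phaseCoeff, Nat.cast_sub ha, hk]
  field_simp
  ring

lemma abs_optGamma_mul (ℓ a : ℕ) {n : ℕ} (hn : 0 < n) :
    |optGamma ℓ a n| * (n : ℝ) ^ ((ℓ : ℤ) - 1) =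
      |(2 : ℝ) ^ ((ℓ : ℤ) - 2) / ((ℓ : ℝ) - 2 * a) * Real.pi| := by
  have hpow : (0 : ℝ) < (n : ℝ) ^ ((ℓ : ℤ) - 1) := zpow_pos (Nat.cast_pos.2 hn) _
  rw [optGamma, mul_div_assoc', abs_div, abs_of_pos hpow, div_mul_cancel₀ _ hpow.ne']

lemma exists_phase_approx {ℓ a : ℕ} (ha : a ≤ ℓ) (hne : (ℓ : ℝ) - 2 * a ≠ 0)
    {s : ∀ n : ℕ, Bits n} {C : ∀ n : ℕ, Bits n → ℤ} (hreg : HasRegularRemainder ℓ a s C) :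
    ∃ φ : ℕ → ℝ, ∀ M : ℝ, 0 < M → ∀ ε : ℝ, 0 < ε → ∀ᶠ n : ℕ in atTop, ∀ k ≤ n,
      |stdScore n k| ≤ M →
      |phase ℓ a (s n) (C n) k - φ n - phaseCoeff ℓ a * stdScore n k ^ 2| ≤ ε := by
  obtain ⟨K, hK⟩ := exists_taylor_bound a (ℓ - a)
  -- The common phase includes the remainder at the central distance `n / 2`, against which the
  -- other remainders are compared.
  refine ⟨fun n => Real.pi * n / (4 * ((ℓ : ℝ) - 2 * a)) + Real.pi * n / 4 +
    optGamma ℓ a n * costRemainder ℓ a (s n) (C n) (n / 2), fun M hM ε hε => ?_⟩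
  set κ : ℝ := |(2 : ℝ) ^ ((ℓ : ℤ) - 2) / ((ℓ : ℝ) - 2 * a) * Real.pi| with hκ
  have hκ0 : 0 ≤ κ := abs_nonneg _
  obtain ⟨δ, hδ, hδr⟩ := hreg (ε / (2 * (κ + 1))) (by positivity)
  set A : ℝ := |Real.pi / (4 * ((ℓ : ℝ) - 2 * a))| with hA
  have hsqrt : Tendsto (fun n : ℕ => √(n : ℝ)) atTop atTop :=
    Real.tendsto_sqrt_atTop.comp tendsto_natCast_atTop_atTop
  -- The lower bounds on `n` ensure, in order: `|u| ≤ 1` for the Taylor bound; `|k/n - 1/2| = |u|/2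
  -- ≤ δ`; the same for the rounded midpoint `n / 2`; and a cubic error of at most `ε/2`.
  filter_upwards [hδr, eventually_gt_atTop 0, hsqrt.eventually_ge_atTop M,
    hsqrt.eventually_ge_atTop (M / (2 * δ)), tendsto_natCast_atTop_atTop.eventually_ge_atTop δ⁻¹,
    hsqrt.eventually_ge_atTop (2 * (A * (|K| * M ^ 3)) / ε)] with n hr hn hM1 hM2 hn2 hM3 k hk hz
  have hn0 : (0 : ℝ) < n := Nat.cast_pos.2 hn
  have hs : √(n : ℝ) ^ 2 = n := Real.sq_sqrt hn0.le
  have hs0 : 0 < √(n : ℝ) := Real.sqrt_pos.2 hn0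
  set u : ℝ := stdScore n k / √n with hu
  have huM : |u| ≤ M / √n := by
    rw [hu, abs_div, abs_of_pos hs0]
    gcongr
  have hu1 : |u| ≤ 1 := huM.trans ((div_le_one hs0).2 hM1)
  have htaylor := hK u hu1
  set E : ℝ := (1 + u) ^ a * (1 - u) ^ (ℓ - a) - (1 + ((a : ℝ) - (ℓ - a : ℕ)) * u +
    (((a : ℝ) - (ℓ - a : ℕ)) ^ 2 - (a + (ℓ - a : ℕ))) / 2 * u ^ 2) with hE
  have hfirst : |Real.pi * n / (4 * ((ℓ : ℝ) - 2 * a)) * E| ≤ ε / 2 := by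
    have hE' : |E| ≤ |K| * (M / √n) ^ 3 :=
      htaylor.trans (mul_le_mul (le_abs_self K) (pow_le_pow_left₀ (abs_nonneg _) huM 3)
        (by positivity) (abs_nonneg _))
    rw [mul_div_right_comm, abs_mul, abs_mul, ← hA, abs_of_pos hn0]
    calc A * n * |E| ≤ A * n * (|K| * (M / √n) ^ 3) := by gcongr
      _ = A * (|K| * M ^ 3) / √n := by
        rw [div_pow, pow_succ (√(n : ℝ)) 2, hs]
        field_simp
      _ ≤ ε / 2 := by
        rw [div_le_iff₀ hs0]
        rw [div_le_iff₀ hε] at hM3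
        linarith
  have hsecond : |optGamma ℓ a n * (costRemainder ℓ a (s n) (C n) k -
      costRemainder ℓ a (s n) (C n) (n / 2))| ≤ ε / 2 := by
    have hkδ : |(k : ℝ) / n - 1 / 2| ≤ δ := by
      have hu' : u = 2 * (k / n) - 1 := by
        rw [hu, stdScore, div_div, ← sq, hs]; field_simp
      have : (k : ℝ) / n - 1 / 2 = u / 2 := by rw [hu']; ring
      rw [this, abs_div, abs_of_pos (two_pos : (0 : ℝ) < 2), div_le_iff₀ two_pos]
      refine huM.trans ((div_le_iff₀ hs0).2 ?_)
      rw [div_le_iff₀ (by positivity)] at hM2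
      linarith
    have hhalf : |((n / 2 : ℕ) : ℝ) / n - 1 / 2| ≤ δ := by
      have h1 : (2 * (n / 2 : ℕ) : ℝ) ≤ n := by exact_mod_cast Nat.mul_div_le n 2
      have h2 : (n : ℝ) ≤ 2 * (n / 2 : ℕ) + 1 := by
        have : n ≤ 2 * (n / 2) + 1 := by lia
        exact_mod_cast this
      have h3 : 1 ≤ n * δ := (inv_le_iff_one_le_mul₀ hδ).1 hn2
      rw [div_sub' hn0.ne', abs_div, abs_of_pos hn0, div_le_iff₀ hn0, abs_le]
      constructor <;> linarith
    have hrk := hr k (n / 2) hk (Nat.div_le_self n 2) hkδ hhalf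
    rw [abs_mul]
    calc _ ≤ |optGamma ℓ a n| * (ε / (2 * (κ + 1)) * (n : ℝ) ^ ((ℓ : ℤ) - 1)) := by gcongr
      _ = κ * (ε / (2 * (κ + 1))) := by rw [hκ, ← abs_optGamma_mul ℓ a hn]; ring
      _ ≤ (κ + 1) * (ε / (2 * (κ + 1))) := by gcongr; linarith
      _ = ε / 2 := by field_simp
  rw [phase_eq ha hne hn (s n) (C n) hu]
  calc _ = |Real.pi * n / (4 * ((ℓ : ℝ) - 2 * a)) * E + optGamma ℓ a n *
        (costRemainder ℓ a (s n) (C n) k - costRemainder ℓ a (s n) (C n) (n / 2))| := by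
        congr 1; ring
    _ ≤ ε := (abs_add_le _ _).trans (by linarith)

/-! ### The success probability -/

/-- Sine and cosine have equal modulus at `±π/4`, which makes the weights exactly binomial, and
`(iσ)^k = e^{iσπk/2}` joins the cost phase. Reversing both signs thus only conjugates the amplitude.
-/
lemma qaoaState_opt_eq {n : ℕ} (ℓ a : ℕ) {s : Bits n} {C : Bits n → ℤ}
    (hC : IsSymmetricRel (⊤ : Subgroup (Equiv.Perm (Fin n))) s C) {σ : ℝ} (hσ : σ = 1 ∨ σ = -1) :
    qaoaState C (σ * optGamma ℓ a n) (σ * (Real.pi / 4)) s =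
      ∑ k ∈ Finset.range (n + 1), binomWeight n k *
        Complex.exp (Complex.I * (σ * phase ℓ a s C k : ℝ)) := by
  have hcos : Real.cos (σ * (Real.pi / 4)) = √2 / 2 := by
    rcases hσ with rfl | rfl <;> simp
  have hsin : Real.sin (σ * (Real.pi / 4)) = σ * (√2 / 2) := by
    rcases hσ with rfl | rfl <;> simp
  have hI : Complex.I * σ = Complex.exp (Complex.I * (σ * (Real.pi / 2))) := by
    rcases hσ with rfl | rfl
    · simp [mul_comm Complex.I, Complex.exp_pi_div_two_mul_I]
    · rw [mul_comm Complex.I (_ * _)]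
      simp only [Complex.ofReal_neg, Complex.ofReal_one, neg_mul, one_mul, mul_neg, mul_one]
      rw [← neg_mul, ← neg_div, Complex.exp_neg_pi_div_two_mul_I]
  rw [qaoaState_apply_self hC, ← Complex.ofReal_cos, ← Complex.ofReal_sin, hcos, hsin]
  refine Finset.sum_congr rfl fun k hk => ?_
  have hkn : k ≤ n := Nat.lt_succ_iff.1 (Finset.mem_range.1 hk)
  have hpow : (√2 / 2) ^ (n - k) * (√2 / 2) ^ k * (√(2 ^ n))⁻¹ = ((2 : ℝ) ^ n)⁻¹ := by
    have hs : √((2 : ℝ) ^ n) = √2 ^ n := by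
      rw [Real.sqrt_eq_iff_mul_self_eq (by positivity) (by positivity), ← mul_pow,
        Real.mul_self_sqrt (by norm_num)]
    rw [← pow_add, Nat.sub_add_cancel hkn, hs, div_pow]
    field_simp
  have hexp : Complex.exp (Complex.I * (σ * phase ℓ a s C k : ℝ)) = (Complex.I * σ) ^ k *
      Complex.exp (Complex.I * ((σ * optGamma ℓ a n : ℝ) * costAtDistance s C k)) := by
    rw [hI, ← Complex.exp_nat_mul, ← Complex.exp_add, phase]
    congr 1
    push_cast
    ring
  have hweight : binomWeight n k =
      n.choose k * ((√2 / 2) ^ (n - k) * (√2 / 2) ^ k * (√(2 ^ n))⁻¹) := by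
    rw [hpow, binomWeight, div_eq_mul_inv]
  rw [hexp, hweight]
  push_cast
  ring

lemma norm_exp_I_mul_sub_le (x y : ℝ) :
    ‖Complex.exp (Complex.I * x) - Complex.exp (Complex.I * y)‖ ≤ |x - y| := by
  have : Complex.exp (Complex.I * x) - Complex.exp (Complex.I * y) =
      Complex.exp (Complex.I * y) * (Complex.exp (Complex.I * (x - y : ℝ)) - 1) := by
    rw [mul_sub, ← Complex.exp_add, mul_one]
    congr 2
    push_cast
    ring
  rw [this, norm_mul, Complex.norm_exp_I_mul_ofReal, one_mul]
  exact Real.norm_exp_I_mul_ofReal_sub_one_le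

lemma limitProb_eq {ℓ a : ℕ} (hne : (ℓ : ℝ) - 2 * a ≠ 0) {σ : ℝ} (hσ : σ = 1 ∨ σ = -1) :
    limitProb ℓ a = (1 + 4 * (σ * phaseCoeff ℓ a) ^ 2) ^ (-(1 / 2) : ℝ) := by
  have hσ2 : σ ^ 2 = 1 := by rcases hσ with rfl | rfl <;> norm_num
  rw [limitProb, mul_pow, hσ2, phaseCoeff]
  congr 1
  field_simp
  ring

lemma limitProb_pos (ℓ a : ℕ) : 0 < limitProb ℓ a := by
  unfold limitProb; positivity

lemma tendsto_qaoaProb {ℓ a : ℕ} (ha : a ≤ ℓ) (hne : (ℓ : ℝ) - 2 * a ≠ 0)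
    {s : ∀ n : ℕ, Bits n} {C : ∀ n : ℕ, Bits n → ℤ}
    (hsymm : ∀ n : ℕ, IsSymmetricRel (⊤ : Subgroup (Equiv.Perm (Fin n))) (s n) (C n))
    (hreg : HasRegularRemainder ℓ a s C) {σ : ℝ} (hσ : σ = 1 ∨ σ = -1) :
    Tendsto (fun n : ℕ => qaoaProb (C n) (σ * optGamma ℓ a n) (σ * (Real.pi / 4)) (s n))
      atTop (𝓝 (limitProb ℓ a)) := by
  obtain ⟨φ, hφ⟩ := exists_phase_approx ha hne hreg
  have hσ1 : |σ| = 1 := by rcases hσ with rfl | rfl <;> simp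
  have hlim := tendsto_binomial_average
    (g := fun x => Complex.exp (Complex.I * (σ * phaseCoeff ℓ a * x ^ 2 : ℝ)))
    (F := fun n k => Complex.exp (Complex.I * (σ * (phase ℓ a (s n) (C n) k - φ n) : ℝ)))
    (by fun_prop) (fun x => (Complex.norm_exp_I_mul_ofReal _).le)
    (fun n k => (Complex.norm_exp_I_mul_ofReal _).le) (fun M hM ε hε => by
      filter_upwards [hφ M hM ε hε] with n hn k hk hz
      refine (norm_exp_I_mul_sub_le _ _).trans ?_
      rw [mul_assoc, ← mul_sub, abs_mul, hσ1, one_mul]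
      exact hn k hk hz)
  have hsq := (hlim.norm).pow 2
  rw [norm_sq_integral_gaussianReal_exp_sq, ← limitProb_eq hne hσ] at hsq
  refine hsq.congr fun n => ?_
  rw [qaoaProb, qaoaState_opt_eq ℓ a (hsymm n) hσ]
  -- The phase `φ n`, which need not converge, factors out of the sum and disappears in the modulus.
  have hfactor : ∑ k ∈ Finset.range (n + 1), (binomWeight n k : ℂ) *
      Complex.exp (Complex.I * (σ * phase ℓ a (s n) (C n) k : ℝ)) =
      Complex.exp (Complex.I * (σ * φ n : ℝ)) * ∑ k ∈ Finset.range (n + 1), binomWeight n k *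
        Complex.exp (Complex.I * (σ * (phase ℓ a (s n) (C n) k - φ n) : ℝ)) := by
    rw [Finset.mul_sum]
    refine Finset.sum_congr rfl fun k _ => ?_
    rw [mul_left_comm, ← Complex.exp_add]
    congr 2
    push_cast
    ring
  rw [hfactor, norm_mul, Complex.norm_exp_I_mul_ofReal, one_mul]

theorem theorem2 (ℓ a : ℕ) (ha : a ≤ ℓ) (hne : ℓ ≠ 2 * a)
    (s : ∀ n : ℕ, Bits n) (C : ∀ n : ℕ, Bits n → ℤ)
    (hsymm : ∀ n : ℕ, IsSymmetricRel (⊤ : Subgroup (Equiv.Perm (Fin n))) (s n) (C n))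
    (hform : HasLeadingForm ℓ a s C)
    (hlower : HasBoundedLocality C ∨ HasRegularRemainder ℓ a s C)
    (σ : ℝ) (hσ : σ = 1 ∨ σ = -1) :
    (∃ δ : ℝ, 0 < δ ∧ ∀ᶠ n : ℕ in atTop,
      δ ≤ qaoaProb (C n) (σ * optGamma ℓ a n) (σ * (Real.pi / 4)) (s n)) ∧
    Tendsto (fun n : ℕ => qaoaProb (C n) (σ * optGamma ℓ a n) (σ * (Real.pi / 4)) (s n))
      atTop (𝓝 (limitProb ℓ a)) := by
  have hreg : HasRegularRemainder ℓ a s C :=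
    hlower.elim (HasBoundedLocality.hasRegularRemainder ha hsymm hform) id
  have hne' : (ℓ : ℝ) - 2 * a ≠ 0 := sub_ne_zero.2 (by exact_mod_cast hne)
  have hlim := tendsto_qaoaProb ha hne' hsymm hreg hσ
  have hpos := limitProb_pos ℓ a
  exact ⟨⟨limitProb ℓ a / 2, half_pos hpos, hlim.eventually_const_le (half_lt_self hpos)⟩, hlim⟩
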